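/- Let $d\ge 0$ and $m\ge 1$ be integers and let $Y$ be a finite or countable set of labels. Let $(D_y)_{y\in Y}$ be a probability distribution on $Y$ and, for each $y\in Y$, let $\mathcal N_y$ be the Gaussian law on $\mathbb R^d$ with independent coordinates $x_i\sim\mathcal N(\mu_{y,i},\sigma_{y,i}^2)$, where $\mu_{y,i}\in\mathbb R$ and $\sigma_{y,i}\ge 0$. Let $D$ be the law of a pair $(x,y)\in\mathbb R^d\times Y$ in which $y$ has distribution $(D_y)$ and $x\sim\mathcal N_y$ given $y$ (a Gaussian mixture). Let $\ell(w,x,y)\in\mathbb R$ be a loss function that is differentiable in $x\in\mathbb R^d$ for all parameters $w$ and labels $y$, and that is $D$-integrable for every $w$. Write $L_D(w)=\mathbb E_{(x,y)\sim D}\,\ell(w,x,y)$ and, for a sample $S=((x_1,y_1),\dots,(x_m,y_m))\sim D^m$ of independent draws from $D$, $L_S(w)=\frac1m\sum_{i=1}^m\ell(w,x_i,y_i)$. Let $\lambda>0$. Assume that the loss per label is balanced: for every $w$ and every $\alpha\in(0,\lambda/m]$ there is a finite number $c=c(w,\alpha)$ such that $$\mathbb E_{x\sim\mathcal N_y}\big[e^{-\alpha\ell(w,x,y)}\big]=c(w,\alpha)\qquad\text{for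 every } y\in Y.$$ Then for every $w$ the variable $e^{\lambda(L_D(w)-L_S(w))}$ is integrable and $$\log\Big(\mathbb E_{S\sim D^m}\big[e^{\lambda(L_D(w)-L_S(w))}\big]\Big)\le\frac{\lambda}{2}\,\mathbb E_{(x,y)\sim D}\Big[\|\sigma_y\cdot\nabla_x\ell(w,x,y)\|^2\int_0^{\lambda/m}\frac{e^{-\alpha\ell(w,x,y)}}{\mathbb E_{(x',y')\sim D}\big[e^{-\alpha\ell(w,x',y')}\big]}\,d\alpha\Big],$$ where $\sigma_y\cdot\nabla_x\ell$ is the coordinatewise product, $\|\cdot\|$ is the Euclidean norm, and the right-hand side is the expectation of a nonnegative function, with values in $[0,+\infty]$. -/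

import Mathlib

open MeasureTheory ProbabilityTheory

noncomputable section

/-- The Gaussian law on `ℝ^d` with independent coordinates `x_i ∼ N(μ_i, σ_i²)`. -/
def diagGaussian {d : ℕ} (μ : Fin d → ℝ) (σ : Fin d → NNReal) :
    Measure (EuclideanSpace ℝ (Fin d)) :=
  (Measure.pi fun i => gaussianReal (μ i) (σ i ^ 2)).map (WithLp.toLp 2)

/-- The data distribution on pairs `(x, y)`: the label `y` has law `p`, and given `y` the
instance `x` has the law `diagGaussian (μ y) (σ y)`. -/
def gaussianMixture {d : ℕ} {Y : Type*} [MeasurableSpace Y] (p : PMF Y)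
    (μ : Y → Fin d → ℝ) (σ : Y → Fin d → NNReal) :
    Measure (EuclideanSpace ℝ (Fin d) × Y) :=
  Measure.sum fun y => p y • (diagGaussian (μ y) (σ y)).map fun x => (x, y)

/-- The risk of the parameter `w`: the expected loss under the data distribution `D`. -/
def risk {d : ℕ} {Y W : Type*} [MeasurableSpace Y]
    (D : Measure (EuclideanSpace ℝ (Fin d) × Y))
    (loss : W → EuclideanSpace ℝ (Fin d) → Y → ℝ) (w : W) : ℝ :=
  ∫ z, loss w z.1 z.2 ∂D

/-- The empirical risk of the parameter `w` on a sample `S` of size `m`. -/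
def empiricalRisk {d m : ℕ} {Y W : Type*}
    (loss : W → EuclideanSpace ℝ (Fin d) → Y → ℝ)
    (S : Fin m → EuclideanSpace ℝ (Fin d) × Y) (w : W) : ℝ :=
  (1 / (m : ℝ)) * ∑ i, loss w (S i).1 (S i).2

/-- The vector `σ_y · ∇_x ℓ(w, x, y)` (coordinatewise product). -/
def scaledGradient {d : ℕ} {Y W : Type*} (σ : Y → Fin d → NNReal)
    (loss : W → EuclideanSpace ℝ (Fin d) → Y → ℝ) (w : W)
    (x : EuclideanSpace ℝ (Fin d)) (y : Y) : EuclideanSpace ℝ (Fin d) :=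
  WithLp.toLp 2 fun i => (σ y i : ℝ) * gradient (fun x' => loss w x' y) x i

end

/-! Write `M α` for the mean of `exp (-α ℓ)` under `D`, and `b = λ/m`. Independence turns the left
side into `λ (log M(b) / b + L_D)`. Herbst's argument treats the bracket: `log M(α) / α` tends to
`-L_D` as `α → 0+`, and its derivative is the entropy of `exp (-α ℓ)` divided by `α² M(α)`. The
bracket is therefore bounded by an integral of normalized entropies over `(0, b)`
(`ofReal_log_integral_exp_div_add_le`).

The Gaussian logarithmic Sobolev inequality bounds each entropy by half the mean of `‖σ · ∇(α ℓ)‖²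
exp (-α ℓ)`; the factors `α²` cancel, and Tonelli gives the claim. For a mixture, the entropy is the
average of the entropies of the components plus the entropy of their means. Balance makes the means
equal, so the second term vanishes (`gaussianMixture_logSobolev`).

The Sobolev inequality itself is proved on the line by monotone transport of `exp f` times the
Gaussian density to the Gaussian density (`gaussianPDF_logSobolev_normalized`). It passes to
products by subadditivity of entropy (`ofReal_expEntropy_prod_le`) and to general variances by an
affine map. -/

/-! ### Distribution functions and monotone transport on the line -/

lemma hasDerivAt_setIntegral_Iic {h : ℝ → ℝ} (hc : Continuous h) (hi : Integrable h) (x : ℝ) :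
    HasDerivAt (fun x => ∫ t in Set.Iic x, h t) (h x) x := by
  have key : (fun x => ∫ t in Set.Iic x, h t) =
      fun x => (∫ t in Set.Iic (0 : ℝ), h t) + ∫ t in (0 : ℝ)..x, h t := by
    funext x
    rw [← intervalIntegral.integral_Iic_sub_Iic hi.integrableOn hi.integrableOn]
    ring
  rw [key]
  exact (intervalIntegral.integral_hasDerivAt_right (hc.intervalIntegrable _ _)
    (hc.stronglyMeasurableAtFilter _ _) hc.continuousAt).const_add _

lemma tendsto_setIntegral_Iic_atTop {h : ℝ → ℝ} (hi : Integrable h) :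
    Filter.Tendsto (fun x => ∫ t in Set.Iic x, h t) Filter.atTop (nhds (∫ t, h t)) :=
  (aecover_Iic Filter.tendsto_id).integral_tendsto_of_countably_generated hi

lemma tendsto_setIntegral_Iic_atBot {h : ℝ → ℝ} (hi : Integrable h) :
    Filter.Tendsto (fun x => ∫ t in Set.Iic x, h t) Filter.atBot (nhds 0) := by
  have h1 := (aecover_Ioi (μ := volume) (l := Filter.atBot)
    (a := fun x : ℝ => x) Filter.tendsto_id).integral_tendsto_of_countably_generated hi
  have h2 : (fun x => ∫ t in Set.Iic x, h t) =
      fun x => (∫ t, h t) - ∫ t in Set.Ioi x, h t := by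
    funext x
    rw [← intervalIntegral.integral_Iic_add_Ioi (b := x) hi.integrableOn hi.integrableOn]
    ring
  rw [h2]
  simpa using h1.const_sub (∫ t, h t)

/-- Intermediate value theorem: strict monotonicity keeps the primitive of `h` strictly between `0`
and the common mass, which are the limits of the primitive of `k`. -/
lemma exists_setIntegral_Iic_eq {h k : ℝ → ℝ} (hh : Continuous h) (hk : Continuous k)
    (hp : ∀ x, 0 < h x) (hhi : Integrable h) (hki : Integrable k)
    (heq : ∫ t, h t = ∫ t, k t) (x : ℝ) :
    ∃ t, ∫ s in Set.Iic t, k s = ∫ s in Set.Iic x, h s := by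
  have hmono : StrictMono (fun x => ∫ t in Set.Iic x, h t) :=
    strictMono_of_hasDerivAt_pos (fun x => hasDerivAt_setIntegral_Iic hh hhi x) hp
  have hcont : Continuous (fun x => ∫ t in Set.Iic x, k t) :=
    continuous_iff_continuousAt.2 fun x => (hasDerivAt_setIntegral_Iic hk hki x).continuousAt
  have h0 : 0 < ∫ s in Set.Iic x, h s :=
    (hmono.monotone.le_of_tendsto (tendsto_setIntegral_Iic_atBot hhi) (x - 1)).trans_lt
      (hmono (by linarith))
  have h1 : ∫ s in Set.Iic x, h s < ∫ t, k t := heq ▸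
    (hmono (show x < x + 1 by linarith)).trans_le
      (hmono.monotone.ge_of_tendsto (tendsto_setIntegral_Iic_atTop hhi) (x + 1))
  obtain ⟨a, ha⟩ := ((tendsto_setIntegral_Iic_atBot hki).eventually_lt_const h0).exists
  obtain ⟨b, hb⟩ := ((tendsto_setIntegral_Iic_atTop hki).eventually_const_lt h1).exists
  exact mem_range_of_exists_le_of_exists_ge hcont ⟨a, ha.le⟩ ⟨b, hb.le⟩

/-- Monotone transport between two continuous positive densities of equal mass. -/
lemma exists_monotone_transport {h k : ℝ → ℝ} (hh : Continuous h) (hk : Continuous k)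
    (hp : ∀ x, 0 < h x) (kp : ∀ x, 0 < k x) (hhi : Integrable h) (hki : Integrable k)
    (heq : ∫ t, h t = ∫ t, k t) :
    ∃ T : ℝ → ℝ, StrictMono T ∧ Function.Surjective T ∧
      ∀ x, HasDerivAt T (h x / k (T x)) x := by
  have hmono : StrictMono (fun x => ∫ t in Set.Iic x, h t) :=
    strictMono_of_hasDerivAt_pos (fun x => hasDerivAt_setIntegral_Iic hh hhi x) hp
  have kmono : StrictMono (fun x => ∫ t in Set.Iic x, k t) :=
    strictMono_of_hasDerivAt_pos (fun x => hasDerivAt_setIntegral_Iic hk hki x) kp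
  choose T hT using exists_setIntegral_Iic_eq hh hk hp hhi hki heq
  have Tmono : StrictMono T := by
    intro x y hxy
    apply kmono.lt_iff_lt.1
    simp only [hT]
    exact hmono hxy
  have Tsurj : Function.Surjective T := by
    intro t
    obtain ⟨x, hx⟩ := exists_setIntegral_Iic_eq hk hh kp hki hhi heq.symm t
    refine ⟨x, kmono.injective ?_⟩
    simp only [hT, hx]
  have Tcont : Continuous T := Tmono.monotone.continuous_of_surjective Tsurj
  refine ⟨T, Tmono, Tsurj, fun x => ?_⟩
  have hs : HasStrictDerivAt (fun x => ∫ t in Set.Iic x, k t) (k (T x)) (T x) :=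
    hasStrictDerivAt_of_hasDerivAt_of_continuousAt
      (Filter.Eventually.of_forall fun y => hasDerivAt_setIntegral_Iic hk hki y) hk.continuousAt
  have hne : k (T x) ≠ 0 := (kp _).ne'
  have hinv := (hs.to_localInverse hne).hasDerivAt
  have hcomp := HasDerivAt.comp x (hT x ▸ hinv) (hasDerivAt_setIntegral_Iic hh hhi x)
  -- Continuity keeps `T` near `T x`, where it coincides with the local inverse of the primitive of
  -- `k` applied to the primitive of `h`.
  have hev := Tcont.continuousAt.eventually (hs.hasStrictFDerivAt_equiv hne).eventually_left_inverse
  rw [div_eq_inv_mul]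
  refine hcomp.congr_of_eventuallyEq ?_
  filter_upwards [hev] with y hy
  rw [← hy]
  simp only [Function.comp, hT]

/-! ### The Gaussian logarithmic Sobolev inequality on the line -/

/-- Replaces decay at infinity: boundary terms with an integrable bound are small at arbitrarily
large radii. -/
lemma not_eventually_le_of_integrable {k : ℝ → ℝ} (hk : Integrable k) {ε : ℝ} (hε : 0 < ε) :
    ¬ ∀ᶠ R in Filter.atTop, ε ≤ k R := by
  intro h
  obtain ⟨R, hR⟩ := Filter.eventually_atTop.1 h
  have h1 := hk.measure_ge_lt_top hε
  have h2 : volume (Set.Ici R) ≤ volume {a | ε ≤ k a} := measure_mono fun x hx => hR x hx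
  rw [Real.volume_Ici] at h2
  exact absurd h1 (not_lt.2 h2)

lemma hasDerivAt_gaussianPDFReal (x : ℝ) :
    HasDerivAt (gaussianPDFReal 0 1) (-x * gaussianPDFReal 0 1 x) x := by
  have h1 : HasDerivAt (fun x : ℝ => -(x - 0) ^ 2 / (2 * ((1 : NNReal) : ℝ))) (-x) x := by
    have := (((hasDerivAt_id x).sub_const 0).pow 2).neg.div_const (2 * ((1 : NNReal) : ℝ))
    refine this.congr_deriv ?_
    simp
    ring
  have h2 := (h1.exp).const_mul (Real.sqrt (2 * Real.pi * ((1 : NNReal) : ℝ)))⁻¹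
  rw [gaussianPDFReal_def]
  refine h2.congr_deriv ?_
  ring

lemma gaussianPDFReal_eq_exp (x t : ℝ) :
    gaussianPDFReal 0 1 x / gaussianPDFReal 0 1 t = Real.exp (t ^ 2 / 2 - x ^ 2 / 2) := by
  have h : (Real.sqrt (2 * Real.pi * ((1 : NNReal) : ℝ)))⁻¹ ≠ 0 := by
    have : 0 < Real.sqrt (2 * Real.pi * ((1 : NNReal) : ℝ)) := Real.sqrt_pos.2 (by positivity)
    positivity
  rw [gaussianPDFReal_def]
  simp only
  rw [mul_div_mul_left _ _ h, ← Real.exp_sub]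
  congr 1
  simp
  ring

/-- Gaussian logarithmic Sobolev inequality on the line for a normalized density `exp f`. -/
lemma gaussianPDF_logSobolev_normalized {f : ℝ → ℝ} (hf : Differentiable ℝ f)
    (hF : Integrable fun x => Real.exp (f x) * gaussianPDFReal 0 1 x)
    (hF1 : ∫ x, Real.exp (f x) * gaussianPDFReal 0 1 x = 1)
    (hfF : Integrable fun x => f x * (Real.exp (f x) * gaussianPDFReal 0 1 x))
    (hE : Integrable fun x => deriv f x ^ 2 * (Real.exp (f x) * gaussianPDFReal 0 1 x)) :
    ∫ x, f x * (Real.exp (f x) * gaussianPDFReal 0 1 x) ≤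
      1 / 2 * ∫ x, deriv f x ^ 2 * (Real.exp (f x) * gaussianPDFReal 0 1 x) := by
  set φ := gaussianPDFReal 0 1 with hφ
  have φp : ∀ x, 0 < φ x := fun x => gaussianPDFReal_pos _ _ _ one_ne_zero
  have φd : ∀ x, HasDerivAt φ (-x * φ x) x := hasDerivAt_gaussianPDFReal
  have φc : Continuous φ := continuous_iff_continuousAt.2 fun x => (φd x).continuousAt
  set h : ℝ → ℝ := fun x => Real.exp (f x) * φ x with hh
  have hp : ∀ x, 0 < h x := fun x => mul_pos (Real.exp_pos _) (φp x)
  have hd : ∀ x, HasDerivAt h (deriv f x * h x - x * h x) x := fun x =>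
    (((hf x).hasDerivAt.exp).mul (φd x)).congr_deriv (by simp only [hh]; ring)
  have hc : Continuous h := continuous_iff_continuousAt.2 fun x => (hd x).continuousAt
  obtain ⟨T, Tmono, Tsurj, Td⟩ := exists_monotone_transport hc φc hp φp hF
    (integrable_gaussianPDFReal 0 1)
    (hF1.trans (integral_gaussianPDFReal_eq_one 0 one_ne_zero).symm)
  -- The derivative of `T` is `h x / φ (T x) = exp (f x + (T x)²/2 - x²/2)`; apply `u + 1 ≤ exp u`.
  have hfle : ∀ x, f x ≤ h x / φ (T x) - 1 + x ^ 2 / 2 - (T x) ^ 2 / 2 := by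
    intro x
    have h1 : h x / φ (T x) = Real.exp (f x + ((T x) ^ 2 / 2 - x ^ 2 / 2)) := by
      rw [Real.exp_add, ← gaussianPDFReal_eq_exp, hh, mul_div_assoc]
    rw [h1]
    linarith [Real.add_one_le_exp (f x + ((T x) ^ 2 / 2 - x ^ 2 / 2))]
  set g : ℝ → ℝ := fun x => f x * h x - 1 / 2 * (deriv f x ^ 2 * h x) with hg
  have gi : Integrable g := hfF.sub (hE.const_mul _)
  have Hd : ∀ x, HasDerivAt (fun x => (T x - x) * h x)
      ((h x / φ (T x) - 1) * h x + (T x - x) * (deriv f x * h x - x * h x)) x := fun x =>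
    ((Td x).sub (hasDerivAt_id x)).mul (hd x)
  -- After `hfle`, what remains of the derivative of `(T x - x) h x` minus `g x` is the square `(T x
  -- - x + f' x)² h x / 2`.
  have hle : ∀ x, g x ≤
      (h x / φ (T x) - 1) * h x + (T x - x) * (deriv f x * h x - x * h x) := by
    intro x
    have h1 := mul_le_mul_of_nonneg_right (hfle x) (hp x).le
    have h2 : 0 ≤ (T x - x + deriv f x) ^ 2 * h x := mul_nonneg (sq_nonneg _) (hp x).le
    simp only [hg]
    linarith
  -- The change of variables `t = T x` reduces this to the first absolute moment of the Gaussian.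
  have Ti : Integrable fun x => |T x| * h x := by
    have hφi : Integrable fun t : ℝ => |t| * φ t := by
      have h1 : Integrable (fun t : ℝ => t) (gaussianReal 0 1) :=
        (memLp_id_gaussianReal 1).integrable le_rfl
      rw [gaussianReal_of_var_ne_zero 0 one_ne_zero] at h1
      rw [integrable_withDensity_iff_integrable_smul₀' (by fun_prop)
        (Filter.Eventually.of_forall fun x => gaussianPDF_lt_top)] at h1
      refine h1.abs.congr (Filter.Eventually.of_forall fun t => ?_)
      simp [toReal_gaussianPDF, abs_mul, abs_of_pos (φp t), ← hφ, mul_comm]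
    have h2 := (integrableOn_image_iff_integrableOn_abs_deriv_smul MeasurableSet.univ
      (fun x _ => (Td x).hasDerivWithinAt) Tmono.injective.injOn
      (fun t : ℝ => |t| * φ t)).1 (by simpa using hφi.integrableOn)
    rw [integrableOn_univ] at h2
    refine h2.congr (Filter.Eventually.of_forall fun x => ?_)
    have hne := (φp (T x)).ne'
    simp only [smul_eq_mul]
    rw [abs_of_pos (div_pos (hp x) (φp _))]
    field_simp
  have hbound : ∀ R : ℝ, 0 < R →
      ∫ x in (-R)..R, g x ≤ |T R| * h R + |T (-R)| * h (-R) := by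
    intro R hR
    have h1 := intervalIntegral.integral_le_sub_of_hasDeriv_right_of_le (a := -R) (b := R)
      (g := fun x => (T x - x) * h x) (φ := g) (by linarith)
      (fun x _ => (Hd x).continuousAt.continuousWithinAt)
      (fun x _ => (Hd x).hasDerivWithinAt) gi.integrableOn (fun x _ => hle x)
    refine h1.trans ?_
    -- The contributions `-R h(R)` and `-R h(-R)` have a favourable sign and are dropped, so no
    -- moment of `h` is needed.
    have h2 := mul_le_mul_of_nonneg_right (le_abs_self (T R)) (hp R).le
    have h3 := mul_le_mul_of_nonneg_right (neg_abs_le (T (-R))) (hp (-R)).le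
    have h4 := mul_pos hR (hp R)
    have h5 := mul_pos hR (hp (-R))
    linarith
  have hlim : Filter.Tendsto (fun R : ℝ => ∫ x in (-R)..R, g x) Filter.atTop
      (nhds (∫ x, g x)) :=
    intervalIntegral_tendsto_integral gi Filter.tendsto_neg_atTop_atBot Filter.tendsto_id
  have hfin : ∫ x, g x ≤ 0 := by
    by_contra hpos
    push Not at hpos
    refine not_eventually_le_of_integrable (Ti.add Ti.comp_neg) (half_pos hpos) ?_
    filter_upwards [hlim.eventually_const_lt (half_lt_self hpos),
      Filter.eventually_gt_atTop 0] with R hR hR0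
    exact hR.le.trans (hbound R hR0)
  rw [hg, integral_sub hfF (hE.const_mul _), integral_const_mul] at hfin
  linarith

lemma integrable_gaussianReal_iff {g : ℝ → ℝ} :
    Integrable g (gaussianReal 0 1) ↔ Integrable fun x => g x * gaussianPDFReal 0 1 x := by
  rw [gaussianReal_of_var_ne_zero 0 one_ne_zero,
    integrable_withDensity_iff_integrable_smul₀' (by fun_prop)
      (Filter.Eventually.of_forall fun x => gaussianPDF_lt_top)]
  simp [toReal_gaussianPDF, mul_comm]

lemma integral_gaussianReal_eq {g : ℝ → ℝ} :
    ∫ x, g x ∂(gaussianReal 0 1) = ∫ x, g x * gaussianPDFReal 0 1 x := by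
  rw [integral_gaussianReal_eq_integral_smul one_ne_zero]
  simp [mul_comm]

/-- The entropy of the function `exp f`. -/
noncomputable def expEntropy {X : Type*} [MeasurableSpace X] (μ : Measure X) (f : X → ℝ) : ℝ :=
  ∫ x, f x * Real.exp (f x) ∂μ -
    (∫ x, Real.exp (f x) ∂μ) * Real.log (∫ x, Real.exp (f x) ∂μ)

/-- Gaussian logarithmic Sobolev inequality on the line. -/
lemma gaussianReal_logSobolev {f : ℝ → ℝ} (hf : Differentiable ℝ f)
    (hF : Integrable (fun x => Real.exp (f x)) (gaussianReal 0 1))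
    (hfF : Integrable (fun x => f x * Real.exp (f x)) (gaussianReal 0 1)) :
    ENNReal.ofReal (expEntropy (gaussianReal 0 1) f) ≤
      1 / 2 * ∫⁻ x, ENNReal.ofReal (deriv f x ^ 2 * Real.exp (f x)) ∂(gaussianReal 0 1) := by
  -- Infinite energy leaves nothing to prove; finite energy supplies the integrability needed below.
  by_cases htop : ∫⁻ x, ENNReal.ofReal (deriv f x ^ 2 * Real.exp (f x)) ∂(gaussianReal 0 1) = ⊤
  · rw [htop]
    simp [ENNReal.mul_top]
  have hE : Integrable (fun x => deriv f x ^ 2 * Real.exp (f x)) (gaussianReal 0 1) := by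
    have hm : Measurable fun x => deriv f x ^ 2 * Real.exp (f x) :=
      ((measurable_deriv f).pow_const 2).mul (Real.measurable_exp.comp hf.continuous.measurable)
    refine ⟨hm.aestronglyMeasurable, ?_⟩
    rw [hasFiniteIntegral_iff_ofReal (Filter.Eventually.of_forall fun x => by positivity)]
    exact Ne.lt_top htop
  set c := ∫ x, Real.exp (f x) ∂(gaussianReal 0 1) with hc
  have cp : 0 < c := integral_exp_pos hF
  -- Subtracting `log c` normalizes the mass and divides both the entropy and the energy by `c`.
  have hexp : ∀ x, Real.exp (f x - Real.log c) = Real.exp (f x) / c := fun x => by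
    rw [Real.exp_sub, Real.exp_log cp]
  have hF' : Integrable (fun x => Real.exp (f x - Real.log c)) (gaussianReal 0 1) := by
    simp_rw [hexp]
    exact hF.div_const c
  have hfF' : Integrable (fun x => (f x - Real.log c) * Real.exp (f x - Real.log c))
      (gaussianReal 0 1) := by
    simp_rw [hexp]
    refine ((hfF.sub (hF.const_mul (Real.log c))).div_const c).congr
      (Filter.Eventually.of_forall fun x => ?_)
    simp only [Pi.sub_apply]
    ring
  have hE' : Integrable (fun x => deriv f x ^ 2 * Real.exp (f x - Real.log c))
      (gaussianReal 0 1) := by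
    simp_rw [hexp, ← mul_div_assoc]
    exact hE.div_const c
  have main := gaussianPDF_logSobolev_normalized (f := fun x => f x - Real.log c)
    (hf.sub_const _) (integrable_gaussianReal_iff.1 hF')
    (by rw [← integral_gaussianReal_eq]; simp_rw [hexp]; rw [integral_div, div_self cp.ne'])
    (by simpa only [mul_assoc] using integrable_gaussianReal_iff.1 hfF')
    (by simpa only [mul_assoc, deriv_sub_const] using integrable_gaussianReal_iff.1 hE')
  simp only [deriv_sub_const, ← mul_assoc] at main
  rw [← integral_gaussianReal_eq, ← integral_gaussianReal_eq] at main
  have e1 : ∫ x, (f x - Real.log c) * Real.exp (f x - Real.log c) ∂(gaussianReal 0 1) =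
      expEntropy (gaussianReal 0 1) f / c := by
    have : ∀ x, (f x - Real.log c) * Real.exp (f x - Real.log c) =
        (f x * Real.exp (f x) - Real.log c * Real.exp (f x)) / c := fun x => by
      rw [hexp]; ring
    simp_rw [this]
    rw [integral_div, integral_sub hfF (hF.const_mul _), integral_const_mul, expEntropy, ← hc]
    ring
  have e2 : ∫ x, deriv f x ^ 2 * Real.exp (f x - Real.log c) ∂(gaussianReal 0 1) =
      (∫ x, deriv f x ^ 2 * Real.exp (f x) ∂(gaussianReal 0 1)) / c := by
    simp_rw [hexp, ← mul_div_assoc]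
    rw [integral_div]
  rw [e1, e2, ← mul_div_assoc, div_le_div_iff_of_pos_right cp] at main
  rw [← ofReal_integral_eq_lintegral_ofReal hE
    (Filter.Eventually.of_forall fun x => by positivity)]
  have half : (1 / 2 : ENNReal) = ENNReal.ofReal (1 / 2) := by
    rw [ENNReal.ofReal_div_of_pos two_pos]; simp
  rw [half, ← ENNReal.ofReal_mul (by norm_num)]
  exact ENNReal.ofReal_le_ofReal main

/-! ### Entropy: variational inequality and subadditivity -/

/-- Pointwise Gibbs inequality: `u + 1 ≤ exp u` at `u = (b - log A) - (a - log B)`, times `exp a`.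
When `B` and `A` are the means of `exp a` and `exp b`, the last two terms on the left cancel upon
integration. -/
lemma exp_mul_le_of_gibbs {B A : ℝ} (hB : 0 < B) (hA : 0 < A) (a b : ℝ) :
    b * Real.exp a - Real.log A * Real.exp a + Real.exp a - B / A * Real.exp b ≤
      a * Real.exp a - Real.log B * Real.exp a := by
  have h := Real.add_one_le_exp ((b - Real.log A) - (a - Real.log B))
  have h2 : Real.exp a * Real.exp ((b - Real.log A) - (a - Real.log B)) = B / A * Real.exp b := by
    rw [← Real.exp_add, show a + ((b - Real.log A) - (a - Real.log B)) =
      Real.log B - Real.log A + b by ring, Real.exp_add, Real.exp_sub, Real.exp_log hB,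
      Real.exp_log hA]
  have h3 := mul_le_mul_of_nonneg_left h (Real.exp_pos a).le
  linarith

lemma ofReal_integral_le_lintegral_ofReal {X : Type*} [MeasurableSpace X] {μ : Measure X}
    {g : X → ℝ} (hg : Integrable g μ) :
    ENNReal.ofReal (∫ x, g x ∂μ) ≤ ∫⁻ x, ENNReal.ofReal (g x) ∂μ := by
  calc ENNReal.ofReal (∫ x, g x ∂μ) ≤ ENNReal.ofReal (∫ x, max (g x) 0 ∂μ) :=
        ENNReal.ofReal_le_ofReal (integral_mono hg hg.pos_part fun x => le_max_left _ _)
    _ = ∫⁻ x, ENNReal.ofReal (g x) ∂μ := by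
        rw [ofReal_integral_eq_lintegral_ofReal hg.pos_part
          (Filter.Eventually.of_forall fun x => le_max_right _ _)]
        simp [ENNReal.ofReal_max]

section

variable {X : Type*} [MeasurableSpace X] {μ : Measure X} [IsProbabilityMeasure μ]

/-- Gibbs variational inequality for the entropy. -/
lemma integral_sub_le_expEntropy {f l : X → ℝ}
    (hF : Integrable (fun x => Real.exp (f x)) μ)
    (hfF : Integrable (fun x => f x * Real.exp (f x)) μ)
    (hlF : Integrable (fun x => l x * Real.exp (f x)) μ)
    (hl : Integrable (fun x => Real.exp (l x)) μ) :
    ∫ x, l x * Real.exp (f x) ∂μ -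
      (∫ x, Real.exp (f x) ∂μ) * Real.log (∫ x, Real.exp (l x) ∂μ) ≤ expEntropy μ f := by
  have hB := integral_exp_pos hF
  have hA := integral_exp_pos hl
  set B := ∫ x, Real.exp (f x) ∂μ with hBd
  set A := ∫ x, Real.exp (l x) ∂μ with hAd
  have h1 : Integrable (fun x => l x * Real.exp (f x) - Real.log A * Real.exp (f x)) μ :=
    hlF.sub (hF.const_mul _)
  have h2 : Integrable (fun x => l x * Real.exp (f x) - Real.log A * Real.exp (f x) +
    Real.exp (f x)) μ := h1.add hF
  have := integral_mono (h2.sub (hl.const_mul (B / A))) (hfF.sub (hF.const_mul (Real.log B)))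
    (fun x => exp_mul_le_of_gibbs hB hA (f x) (l x))
  simp only [Pi.sub_apply] at this
  rw [integral_sub h2 (hl.const_mul _), integral_add h1 hF, integral_sub hlF (hF.const_mul _),
    integral_sub hfF (hF.const_mul _), integral_const_mul, integral_const_mul,
    integral_const_mul, ← hBd, ← hAd, div_mul_cancel₀ _ hA.ne'] at this
  rw [expEntropy, ← hBd]
  linarith

lemma expEntropy_nonneg {f : X → ℝ} (hF : Integrable (fun x => Real.exp (f x)) μ)
    (hfF : Integrable (fun x => f x * Real.exp (f x)) μ) : 0 ≤ expEntropy μ f := by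
  simpa using integral_sub_le_expEntropy (l := fun _ => 0) hF hfF (by simp) (by simp)

/-- Adding `c - exp f`, of mean zero, makes the integrand pointwise nonnegative. The entropy becomes
a Lebesgue integral that can be summed over labels sharing the same `c`. -/
lemma ofReal_expEntropy {f : X → ℝ} (hF : Integrable (fun x => Real.exp (f x)) μ)
    (hfF : Integrable (fun x => f x * Real.exp (f x)) μ) {c : ℝ}
    (hc : ∫ x, Real.exp (f x) ∂μ = c) :
    ENNReal.ofReal (expEntropy μ f) = ∫⁻ x, ENNReal.ofReal
      (f x * Real.exp (f x) - Real.log c * Real.exp (f x) - Real.exp (f x) + c) ∂μ := by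
  have cp : 0 < c := hc ▸ integral_exp_pos hF
  have h1 : Integrable (fun x => f x * Real.exp (f x) - Real.log c * Real.exp (f x)) μ :=
    hfF.sub (hF.const_mul _)
  have h2 : Integrable (fun x => f x * Real.exp (f x) - Real.log c * Real.exp (f x) -
    Real.exp (f x)) μ := h1.sub hF
  have h3 : Integrable (fun x => f x * Real.exp (f x) - Real.log c * Real.exp (f x) -
    Real.exp (f x) + c) μ := h2.add (integrable_const c)
  rw [← ofReal_integral_eq_lintegral_ofReal h3,
    integral_add h2 (integrable_const c), integral_sub h1 hF, integral_sub hfF (hF.const_mul _),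
    integral_const_mul, hc, expEntropy, hc]
  · congr 1
    simp
    ring
  · refine Filter.Eventually.of_forall fun x => ?_
    have h4 := exp_mul_le_of_gibbs cp one_pos (f x) 0
    simp at h4
    simp only [Pi.zero_apply]
    linarith

variable {Z : Type*} [MeasurableSpace Z] {ν : Measure Z} [IsProbabilityMeasure ν]

/-- Subadditivity of the entropy on a product of two probability spaces. -/
lemma ofReal_expEntropy_prod_le {f : X × Z → ℝ} (hf : Measurable f)
    (hF : Integrable (fun z => Real.exp (f z)) (μ.prod ν))
    (hfF : Integrable (fun z => f z * Real.exp (f z)) (μ.prod ν)) :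
    ENNReal.ofReal (expEntropy (μ.prod ν) f) ≤
      ∫⁻ y, ENNReal.ofReal (expEntropy μ fun x => f (x, y)) ∂ν +
      ∫⁻ x, ENNReal.ofReal (expEntropy ν fun y => f (x, y)) ∂μ := by
  set A : Z → ℝ := fun y => ∫ x, Real.exp (f (x, y)) ∂μ with hA
  set l : Z → ℝ := fun y => Real.log (A y) with hl
  have hFm : StronglyMeasurable fun z => Real.exp (f z) :=
    (Real.measurable_exp.comp hf).stronglyMeasurable
  have Am : Measurable A := (hFm.integral_prod_left (μ := μ)).measurable
  have lm : Measurable l := Real.measurable_log.comp Am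
  have Ai : Integrable A ν := hF.integral_prod_right
  have Aeq : ∫ y, A y ∂ν = ∫ z, Real.exp (f z) ∂(μ.prod ν) := (integral_prod_symm _ hF).symm
  have Api : ∀ᵐ y ∂ν, 0 < A y := hF.prod_left_ae.mono fun y hy => integral_exp_pos hy
  have sec : ∀ᵐ y ∂ν, Integrable (fun x => Real.exp (f (x, y))) μ := hF.prod_left_ae
  have sec' : ∀ᵐ y ∂ν, Integrable (fun x => f (x, y) * Real.exp (f (x, y))) μ :=
    hfF.prod_left_ae
  have enn : ∀ᵐ y ∂ν, 0 ≤ expEntropy μ fun x => f (x, y) := by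
    filter_upwards [sec, sec'] with y h1 h2 using expEntropy_nonneg h1 h2
  -- Squeeze: `A - 1 ≤ A log A`, and `A log A` is at most the section integral of `f exp f` because
  -- section entropies are nonnegative.
  have Ali : Integrable (fun y => A y * l y) ν := by
    refine (hfF.integral_prod_right.norm.add (Ai.add (integrable_const 1))).mono'
      (Am.mul lm).aestronglyMeasurable ?_
    filter_upwards [enn, Api] with y h1 h2
    have h3 : A y * l y ≤ ∫ x, f (x, y) * Real.exp (f (x, y)) ∂μ := by
      simpa [expEntropy] using h1
    have h4 : A y - 1 ≤ A y * l y := by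
      have := mul_le_mul_of_nonneg_left (Real.one_sub_inv_le_log_of_pos h2) h2.le
      rwa [mul_sub, mul_one, mul_inv_cancel₀ h2.ne'] at this
    have h5 := le_abs_self (∫ x, f (x, y) * Real.exp (f (x, y)) ∂μ)
    have h6 := abs_nonneg (∫ x, f (x, y) * Real.exp (f (x, y)) ∂μ)
    simp only [Pi.add_apply, Real.norm_eq_abs]
    rw [abs_le]
    constructor <;> linarith
  have Fli : Integrable (fun z : X × Z => l z.2 * Real.exp (f z)) (μ.prod ν) := by
    rw [integrable_prod_iff']
    · refine ⟨sec.mono fun y hy => hy.const_mul (l y), ?_⟩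
      refine Ali.norm.congr ?_
      filter_upwards [Api] with y hy
      simp only [norm_mul, Real.norm_eq_abs, Real.abs_exp]
      rw [integral_const_mul, abs_of_pos hy, mul_comm]
    · exact ((lm.comp measurable_snd).mul hFm.measurable).aestronglyMeasurable
  have Flint : ∫ z : X × Z, l z.2 * Real.exp (f z) ∂(μ.prod ν) = ∫ y, A y * l y ∂ν := by
    rw [integral_prod_symm _ Fli]
    refine integral_congr_ae (Filter.Eventually.of_forall fun y => ?_)
    simp only
    rw [integral_const_mul, mul_comm]
  set C := ∫ z, Real.exp (f z) ∂(μ.prod ν) with hC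
  -- The chain rule for entropy. In the second term, `l` serves as trial function in the Gibbs
  -- inequality on `ν`, since `exp l` has mean `C`.
  have split : expEntropy (μ.prod ν) f =
      (∫ y, expEntropy μ (fun x => f (x, y)) ∂ν) +
      ∫ x, (∫ y, l y * Real.exp (f (x, y)) ∂ν - (∫ y, Real.exp (f (x, y)) ∂ν) * Real.log C)
        ∂μ := by
    have e1 : ∫ y, expEntropy μ (fun x => f (x, y)) ∂ν =
        ∫ z, f z * Real.exp (f z) ∂(μ.prod ν) - ∫ y, A y * l y ∂ν := by
      rw [integral_prod_symm _ hfF, ← integral_sub hfF.integral_prod_right Ali]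
      rfl
    rw [e1, integral_sub Fli.integral_prod_left (hF.integral_prod_left.mul_const _),
      ← integral_prod _ Fli, integral_mul_const, ← integral_prod _ hF, Flint, expEntropy]
    ring
  have enti : Integrable (fun y => expEntropy μ fun x => f (x, y)) ν :=
    hfF.integral_prod_right.sub Ali
  rw [split]
  refine ENNReal.ofReal_add_le.trans (add_le_add ?_ ?_)
  · rw [ofReal_integral_eq_lintegral_ofReal enti enn]
  · refine (ofReal_integral_le_lintegral_ofReal
      (Fli.integral_prod_left.sub (hF.integral_prod_left.mul_const _))).trans
      (lintegral_mono_ae ?_)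
    filter_upwards [hF.prod_right_ae, hfF.prod_right_ae, Fli.prod_right_ae] with x h1 h2 h3
    refine ENNReal.ofReal_le_ofReal ?_
    have hexp : (fun y => Real.exp (l y)) =ᵐ[ν] A := by
      filter_upwards [Api] with y hy using Real.exp_log hy
    have := integral_sub_le_expEntropy (l := l) h1 h2 h3 (Ai.congr hexp.symm)
    rwa [integral_congr_ae hexp, Aeq] at this

end

/-! ### Tensorization to the standard Gaussian law -/

lemma expEntropy_comp {X Z : Type*} [MeasurableSpace X] [MeasurableSpace Z] {μ : Measure X}
    {ν : Measure Z} {e : X → Z} (he : MeasurePreserving e μ ν) {f : Z → ℝ} (hf : Measurable f) :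
    expEntropy μ (f ∘ e) = expEntropy ν f := by
  have h1 : Measurable fun z => Real.exp (f z) := Real.measurable_exp.comp hf
  have h2 : Measurable fun z => f z * Real.exp (f z) := hf.mul h1
  rw [expEntropy, expEntropy, ← he.map_eq,
    integral_map he.measurable.aemeasurable h1.aestronglyMeasurable,
    integral_map he.measurable.aemeasurable h2.aestronglyMeasurable]
  rfl

lemma measurable_lineDeriv_sq_mul_exp {E : Type*} [NormedAddCommGroup E] [NormedSpace ℝ E]
    [MeasurableSpace E] [BorelSpace E] {f : E → ℝ} (hf : Continuous f) (v : E) :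
    Measurable fun x => ENNReal.ofReal (lineDeriv ℝ f x v ^ 2 * Real.exp (f x)) :=
  (((measurable_lineDeriv hf).pow_const 2).mul
    (Real.measurable_exp.comp hf.measurable)).ennreal_ofReal

lemma lineDeriv_finCons_zero {n : ℕ} (f : (Fin (n + 1) → ℝ) → ℝ) (t : ℝ) (y : Fin n → ℝ) :
    lineDeriv ℝ f (Fin.cons t y) (Pi.single 0 1) = deriv (fun s => f (Fin.cons s y)) t := by
  have h : ∀ s : ℝ, (Fin.cons t y : Fin (n + 1) → ℝ) + s • (Pi.single 0 1 : Fin (n + 1) → ℝ) =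
      Fin.cons (t + s) y := by
    intro s
    funext i
    refine Fin.cases ?_ (fun j => ?_) i <;> simp
  simp only [lineDeriv, h]
  rw [deriv_comp_const_add (f := fun s => f (Fin.cons s y))]
  simp

lemma lineDeriv_finCons_succ {n : ℕ} (f : (Fin (n + 1) → ℝ) → ℝ) (t : ℝ) (y : Fin n → ℝ)
    (i : Fin n) :
    lineDeriv ℝ f (Fin.cons t y) (Pi.single i.succ 1) =
      lineDeriv ℝ (fun y' => f (Fin.cons t y')) y (Pi.single i 1) := by
  have h : ∀ s : ℝ, (Fin.cons t y : Fin (n + 1) → ℝ) + s • (Pi.single i.succ 1 : Fin (n + 1) → ℝ) =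
      Fin.cons t (y + s • (Pi.single i 1 : Fin n → ℝ)) := by
    intro s
    funext j
    refine Fin.cases ?_ (fun k => ?_) j <;> simp [Pi.single_apply]
  simp only [lineDeriv, h]

/-- Logarithmic Sobolev inequality for the standard Gaussian law on `Fin n → ℝ`. -/
lemma pi_gaussianReal_logSobolev (n : ℕ) {f : (Fin n → ℝ) → ℝ} (hf : Differentiable ℝ f)
    (hF : Integrable (fun x => Real.exp (f x)) (Measure.pi fun _ => gaussianReal 0 1))
    (hfF : Integrable (fun x => f x * Real.exp (f x)) (Measure.pi fun _ => gaussianReal 0 1)) :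
    ENNReal.ofReal (expEntropy (Measure.pi fun _ => gaussianReal 0 1) f) ≤
      1 / 2 * ∫⁻ x, ∑ i, ENNReal.ofReal (lineDeriv ℝ f x (Pi.single i 1) ^ 2 * Real.exp (f x))
        ∂(Measure.pi fun _ => gaussianReal 0 1) := by
  induction n with
  | zero =>
    have h0 : expEntropy (Measure.pi fun _ : Fin 0 => gaussianReal 0 1) f = 0 := by
      have : f = fun _ => f 0 := funext fun x => congrArg f (Subsingleton.elim _ _)
      rw [this, expEntropy]
      simp
      ring
    rw [h0]
    simp
  | succ n ih =>
    set γ := gaussianReal 0 1 with hγ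
    set e : ℝ × (Fin n → ℝ) → (Fin (n + 1) → ℝ) := fun z => Fin.cons z.1 z.2 with he
    have hmp : MeasurePreserving e (γ.prod (Measure.pi fun _ => γ)) (Measure.pi fun _ => γ) := by
      have := (measurePreserving_piFinSuccAbove (fun _ : Fin (n + 1) => γ) 0).symm
      convert this using 1
      funext z
      simp [he, MeasurableEquiv.piFinSuccAbove, Fin.insertNthEquiv]
    have hfe : Differentiable ℝ (f ∘ e) := 
      hf.comp (differentiable_finCons.2 ⟨differentiable_fst, differentiable_snd⟩)
    have hFe := (hmp.integrable_comp hF.aestronglyMeasurable).2 hF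
    have hfFe := (hmp.integrable_comp hfF.aestronglyMeasurable).2 hfF
    have hm : ∀ i, Measurable fun z => ENNReal.ofReal
        (lineDeriv ℝ f (e z) (Pi.single i 1) ^ 2 * Real.exp (f (e z))) := fun i =>
      (measurable_lineDeriv_sq_mul_exp hf.continuous _).comp hmp.measurable
    rw [← expEntropy_comp hmp hf.continuous.measurable]
    -- Subadditivity separates coordinate `0`, handled on the line, from the others, handled by
    -- induction.
    refine (ofReal_expEntropy_prod_le hfe.continuous.measurable hFe hfFe).trans ?_
    rw [← hmp.lintegral_comp (Finset.measurable_sum _ fun i _ =>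
      measurable_lineDeriv_sq_mul_exp hf.continuous _)]
    simp_rw [Fin.sum_univ_succ]
    rw [lintegral_add_left (hm 0), mul_add]
    refine add_le_add ?_ ?_
    · rw [lintegral_prod_symm' _ (hm 0), ← lintegral_const_mul _ (hm 0).lintegral_prod_left']
      refine lintegral_mono_ae ?_
      filter_upwards [hFe.prod_left_ae, hfFe.prod_left_ae] with y h1 h2
      have hd : Differentiable ℝ fun t : ℝ => (f ∘ e) (t, y) :=
        hfe.comp (differentiable_id.prodMk (differentiable_const y))
      have := gaussianReal_logSobolev hd h1 h2
      simpa only [he, lineDeriv_finCons_zero, Function.comp_apply] using this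
    · have hms : Measurable fun z => ∑ i : Fin n, ENNReal.ofReal
          (lineDeriv ℝ f (e z) (Pi.single i.succ 1) ^ 2 * Real.exp (f (e z))) :=
        Finset.measurable_sum _ fun i _ => hm i.succ
      rw [lintegral_prod _ hms.aemeasurable, ← lintegral_const_mul _ hms.lintegral_prod_right']
      refine lintegral_mono_ae ?_
      filter_upwards [hFe.prod_right_ae, hfFe.prod_right_ae] with t h1 h2
      have hd : Differentiable ℝ fun y : Fin n → ℝ => (f ∘ e) (t, y) :=
        hfe.comp ((differentiable_const t).prodMk differentiable_id)
      have := ih hd h1 h2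
      simpa only [he, lineDeriv_finCons_succ, Function.comp_apply] using this

/-! ### Gaussian laws with independent coordinates -/

section

variable {d : ℕ} (μ : Fin d → ℝ) (σ : Fin d → NNReal)

/-- An affine image of the standard law, also when some `σ i = 0`; degenerate coordinates thus need
no separate treatment. -/
lemma measurePreserving_diagGaussian :
    MeasurePreserving (fun z : Fin d → ℝ => WithLp.toLp 2 fun i => μ i + (σ i : ℝ) * z i)
      (Measure.pi fun _ => gaussianReal 0 1) (diagGaussian μ σ) := by
  have h1 : ∀ i, (gaussianReal 0 1).map (fun t => μ i + (σ i : ℝ) * t) =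
      gaussianReal (μ i) (σ i ^ 2) := by
    intro i
    have : (fun t => μ i + (σ i : ℝ) * t) = (fun t => μ i + t) ∘ fun t => (σ i : ℝ) * t := rfl
    rw [this, ← Measure.map_map (by fun_prop) (by fun_prop), gaussianReal_map_const_mul,
      gaussianReal_map_const_add]
    congr 1
    · simp
    · ext; simp
  have h2 := Measure.pi_map_pi (μ := fun _ : Fin d => gaussianReal 0 1)
    (f := fun i t => μ i + (σ i : ℝ) * t)
    (hμ := fun i => by rw [h1]; infer_instance) (fun i => by fun_prop)
  refine ⟨by fun_prop, ?_⟩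
  simp only [h1] at h2
  rw [diagGaussian, ← h2, Measure.map_map (by fun_prop) (by fun_prop)]
  rfl

instance : IsProbabilityMeasure (diagGaussian μ σ) :=
  (measurePreserving_diagGaussian μ σ).map_eq ▸
    Measure.isProbabilityMeasure_map (measurePreserving_diagGaussian μ σ).aemeasurable

lemma measurable_gradient (f : EuclideanSpace ℝ (Fin d) → ℝ) : Measurable (gradient f) :=
  (InnerProductSpace.toDual ℝ (EuclideanSpace ℝ (Fin d))).symm.continuous.measurable.comp
    (measurable_fderiv ℝ f)

lemma measurable_toLp_mul_gradient (f : EuclideanSpace ℝ (Fin d) → ℝ) :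
    Measurable fun x => (WithLp.toLp 2 fun i => (σ i : ℝ) * gradient f x i :
      EuclideanSpace ℝ (Fin d)) := by
  have := measurable_gradient f
  refine (WithLp.measurable_toLp 2 _).comp (measurable_pi_lambda _ fun i => ?_)
  exact ((EuclideanSpace.proj (𝕜 := ℝ) i).continuous.measurable.comp this).const_mul _

lemma lineDeriv_comp_toLp_add_mul {f : EuclideanSpace ℝ (Fin d) → ℝ} (hf : Differentiable ℝ f)
    (z : Fin d → ℝ) (i : Fin d) :
    lineDeriv ℝ (fun z : Fin d → ℝ => f (WithLp.toLp 2 fun i => μ i + (σ i : ℝ) * z i)) z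
      (Pi.single i 1) =
      σ i * gradient f (WithLp.toLp 2 fun i => μ i + (σ i : ℝ) * z i) i := by
  set x : EuclideanSpace ℝ (Fin d) := WithLp.toLp 2 fun i => μ i + (σ i : ℝ) * z i with hx
  have h : ∀ s : ℝ, (WithLp.toLp 2 fun j => μ j + (σ j : ℝ) * (z + s • (Pi.single i 1 : Fin d → ℝ)) j :
      EuclideanSpace ℝ (Fin d)) = x + s • ((σ i : ℝ) • EuclideanSpace.single i (1 : ℝ)) := by
    intro s
    ext j
    by_cases hj : j = i
    · subst hj
      simp [hx]
      ring
    · simp [hx, hj]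
  have h2 : lineDeriv ℝ (fun z : Fin d → ℝ => f (WithLp.toLp 2 fun i => μ i + (σ i : ℝ) * z i)) z
      (Pi.single i 1) = lineDeriv ℝ f x ((σ i : ℝ) • EuclideanSpace.single i (1 : ℝ)) := by
    simp only [lineDeriv, h]
  rw [h2, (hf x).lineDeriv_eq_fderiv, map_smul, smul_eq_mul]
  congr 1
  have h3 : inner ℝ (gradient f x) (EuclideanSpace.single i (1 : ℝ)) =
      fderiv ℝ f x (EuclideanSpace.single i (1 : ℝ)) := InnerProductSpace.toDual_symm_apply
  rw [← h3, EuclideanSpace.inner_single_right]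
  simp

/-- Logarithmic Sobolev inequality for a Gaussian law with independent coordinates. -/
lemma diagGaussian_logSobolev {f : EuclideanSpace ℝ (Fin d) → ℝ} (hf : Differentiable ℝ f)
    (hF : Integrable (fun x => Real.exp (f x)) (diagGaussian μ σ))
    (hfF : Integrable (fun x => f x * Real.exp (f x)) (diagGaussian μ σ)) :
    ENNReal.ofReal (expEntropy (diagGaussian μ σ) f) ≤
      1 / 2 * ∫⁻ x, ENNReal.ofReal (‖(WithLp.toLp 2 fun i => (σ i : ℝ) * gradient f x i :
        EuclideanSpace ℝ (Fin d))‖ ^ 2 * Real.exp (f x)) ∂(diagGaussian μ σ) := by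
  have hmp := measurePreserving_diagGaussian μ σ
  have hd : Differentiable ℝ fun z : Fin d → ℝ =>
      f (WithLp.toLp 2 fun i => μ i + (σ i : ℝ) * z i) := by
    refine hf.comp ?_
    have : Differentiable ℝ fun z : Fin d → ℝ => fun i => μ i + (σ i : ℝ) * z i := by fun_prop
    exact (PiLp.continuousLinearEquiv 2 ℝ (fun _ : Fin d => ℝ)).symm.differentiable.comp this
  have := pi_gaussianReal_logSobolev d hd
    ((hmp.integrable_comp hF.aestronglyMeasurable).2 hF)
    ((hmp.integrable_comp hfF.aestronglyMeasurable).2 hfF)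
  have hent := expEntropy_comp hmp hf.continuous.measurable
  simp only [Function.comp_def] at hent
  rw [hent] at this
  have hm : Measurable fun x => ENNReal.ofReal (‖(WithLp.toLp 2 fun i =>
      (σ i : ℝ) * gradient f x i : EuclideanSpace ℝ (Fin d))‖ ^ 2 * Real.exp (f x)) :=
    (((measurable_toLp_mul_gradient σ f).norm.pow_const 2).mul
      (Real.measurable_exp.comp hf.continuous.measurable)).ennreal_ofReal
  rw [← hmp.lintegral_comp hm]
  refine this.trans (le_of_eq ?_)
  congr 1
  refine lintegral_congr fun z => ?_
  rw [← ENNReal.ofReal_sum_of_nonneg (fun i _ => by positivity), EuclideanSpace.real_norm_sq_eq,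
    Finset.sum_mul]
  simp only [lineDeriv_comp_toLp_add_mul μ σ hf]

end

/-! ### Herbst's argument -/

lemma exp_neg_mul_le_one_add {b α u : ℝ} (h0 : 0 ≤ α) (hb : α ≤ b) :
    Real.exp (-α * u) ≤ 1 + Real.exp (-b * u) := by
  rcases le_total 0 u with hu | hu
  · have : Real.exp (-α * u) ≤ 1 := Real.exp_le_one_iff.2 (by nlinarith)
    linarith [Real.exp_pos (-b * u)]
  · have : Real.exp (-α * u) ≤ Real.exp (-b * u) := Real.exp_le_exp.2 (by nlinarith)
    linarith

/-- Chord slopes of a convex function from a fixed point are monotone. This is the upper bound for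
dominated convergence as `ε → 0+`. -/
lemma exp_neg_mul_sub_one_div_le {b ε u : ℝ} (h0 : 0 < ε) (hb : ε ≤ b) :
    (Real.exp (-ε * u) - 1) / ε ≤ (Real.exp (-b * u) - 1) / b := by
  have bp : 0 < b := h0.trans_le hb
  have h := convexOn_exp.2 (Set.mem_univ (-b * u)) (Set.mem_univ 0)
    (div_nonneg h0.le bp.le) (sub_nonneg.2 ((div_le_one bp).2 hb)) (add_sub_cancel _ _)
  have e : ε / b * (-b * u) = -ε * u := by field_simp
  simp only [smul_eq_mul, mul_zero, add_zero, Real.exp_zero, mul_one, e] at h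
  rw [div_le_div_iff₀ h0 bp]
  have h2 := mul_le_mul_of_nonneg_right h bp.le
  have e2 : (ε / b * Real.exp (-b * u) + (1 - ε / b)) * b =
      ε * Real.exp (-b * u) + b - ε := by
    field_simp
    ring
  linarith

section

variable {Ω : Type*} [MeasurableSpace Ω] {D : Measure Ω} [IsProbabilityMeasure D] {g : Ω → ℝ}
  {b : ℝ}

lemma continuousOn_integral_exp_neg_mul (hg : Measurable g)
    (hint : Integrable (fun ω => Real.exp (-b * g ω)) D) :
    ContinuousOn (fun α : ℝ => ∫ ω, Real.exp (-α * g ω) ∂D) (Set.Icc 0 b) := by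
  refine continuousOn_of_dominated (bound := fun ω => 1 + Real.exp (-b * g ω))
    (fun α _ => (by fun_prop)) (fun α hα => Filter.Eventually.of_forall fun ω => ?_)
    ((integrable_const 1).add hint) (Filter.Eventually.of_forall fun ω => by fun_prop)
  rw [Real.norm_eq_abs, Real.abs_exp]
  exact exp_neg_mul_le_one_add hα.1 hα.2

lemma tendsto_integral_exp_neg_mul_sub_one_div (hg : Measurable g) (hgi : Integrable g D)
    (hb : 0 < b) (hint : ∀ α ∈ Set.Ioc 0 b, Integrable (fun ω => Real.exp (-α * g ω)) D) :
    Filter.Tendsto (fun ε : ℝ => (∫ ω, Real.exp (-ε * g ω) ∂D - 1) / ε)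
      (nhdsWithin 0 (Set.Ioi 0)) (nhds (-∫ ω, g ω ∂D)) := by
  have hev : ∀ᶠ ε in nhdsWithin (0 : ℝ) (Set.Ioi 0), ε ∈ Set.Ioc 0 b := Ioc_mem_nhdsGT hb
  have hbi := hint b ⟨hb, le_rfl⟩
  have key : Filter.Tendsto (fun ε : ℝ => ∫ ω, (Real.exp (-ε * g ω) - 1) / ε ∂D)
      (nhdsWithin 0 (Set.Ioi 0)) (nhds (∫ ω, -g ω ∂D)) := by
    refine tendsto_integral_filter_of_dominated_convergence
      (fun ω => |g ω| + (Real.exp (-b * g ω) + 1) / b)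
      (Filter.Eventually.of_forall fun ε => by fun_prop) ?_
      (hgi.abs.add ((hbi.add (integrable_const 1)).div_const b)) ?_
    · filter_upwards [hev] with ε hε
      refine Filter.Eventually.of_forall fun ω => ?_
      have h1 := exp_neg_mul_sub_one_div_le (u := g ω) hε.1 hε.2
      have h2 : -g ω ≤ (Real.exp (-ε * g ω) - 1) / ε := by
        rw [le_div_iff₀ hε.1]
        linarith [Real.add_one_le_exp (-ε * g ω)]
      have h3 : (Real.exp (-b * g ω) - 1) / b ≤ (Real.exp (-b * g ω) + 1) / b := by
        gcongr
        linarith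
      have h4 : 0 ≤ (Real.exp (-b * g ω) + 1) / b := by positivity
      rw [Real.norm_eq_abs, abs_le]
      constructor <;> linarith [neg_abs_le (g ω), le_abs_self (g ω), abs_nonneg (g ω)]
    · refine Filter.Eventually.of_forall fun ω => ?_
      have hd : HasDerivAt (fun ε : ℝ => Real.exp (-ε * g ω)) (-g ω) 0 := by
        have := (((hasDerivAt_id (0 : ℝ)).neg).mul_const (g ω)).exp
        simpa using this
      have := hd.tendsto_slope_zero_right
      refine this.congr fun t => ?_
      simp [div_eq_inv_mul]
  rw [integral_neg] at key
  refine key.congr' ?_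
  filter_upwards [hev] with ε hε
  rw [integral_div, integral_sub (hint ε hε) (integrable_const 1)]
  simp

omit [IsProbabilityMeasure D] in
-- Interior exponents allow differentiation under the integral and give integrability of `g exp (-α
-- g)`, neither of which is guaranteed at the endpoint `b`.
lemma Ioo_subset_interior_integrableExpSet
    (hint : ∀ α ∈ Set.Ioc 0 b, Integrable (fun ω => Real.exp (-α * g ω)) D) :
    Set.Ioo 0 b ⊆ interior (integrableExpSet (fun ω => -g ω) D) := by
  refine interior_maximal (fun α hα => ?_) isOpen_Ioo
  simpa [integrableExpSet] using hint α ⟨hα.1, hα.2.le⟩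

omit [IsProbabilityMeasure D] in
lemma integrable_neg_mul_mul_exp
    (hint : ∀ α ∈ Set.Ioc 0 b, Integrable (fun ω => Real.exp (-α * g ω)) D)
    {α : ℝ} (hα : α ∈ Set.Ioo 0 b) :
    Integrable (fun ω => -α * g ω * Real.exp (-α * g ω)) D := by
  have := (integrable_pow_mul_exp_of_mem_interior_integrableExpSet
    (Ioo_subset_interior_integrableExpSet hint hα) 1).const_mul α
  refine this.congr (Filter.Eventually.of_forall fun ω => ?_)
  simp
  ring

/-- The derivative of the normalized cumulant generating function is a normalized entropy. -/
lemma hasDerivAt_log_integral_exp_div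
    (hint : ∀ α ∈ Set.Ioc 0 b, Integrable (fun ω => Real.exp (-α * g ω)) D)
    {α : ℝ} (hα : α ∈ Set.Ioo 0 b) :
    HasDerivAt (fun α : ℝ => Real.log (∫ ω, Real.exp (-α * g ω) ∂D) / α)
      (expEntropy D (fun ω => -α * g ω) / (α ^ 2 * ∫ ω, Real.exp (-α * g ω) ∂D)) α := by
  have hd := hasDerivAt_mgf (Ioo_subset_interior_integrableExpSet hint hα)
  have e : mgf (fun ω => -g ω) D = fun α : ℝ => ∫ ω, Real.exp (-α * g ω) ∂D := by
    funext t
    simp [mgf]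
  rw [e] at hd
  have hM : 0 < ∫ ω, Real.exp (-α * g ω) ∂D := integral_exp_pos (hint α ⟨hα.1, hα.2.le⟩)
  refine ((hd.log hM.ne').div (hasDerivAt_id α) hα.1.ne').congr_deriv ?_
  have h1 : ∫ ω, -α * g ω * Real.exp (-α * g ω) ∂D =
      α * ∫ ω, -g ω * Real.exp (α * -g ω) ∂D := by
    rw [← integral_const_mul]
    refine integral_congr_ae (Filter.Eventually.of_forall fun ω => ?_)
    simp only [neg_mul, mul_neg]
    ring
  have hα0 := hα.1.ne'
  rw [expEntropy, h1]
  simp only [id]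
  generalize ∫ ω, -g ω * Real.exp (α * -g ω) ∂D = N
  generalize ∫ ω, Real.exp (-α * g ω) ∂D = M at hM ⊢
  have hM0 := hM.ne'
  field_simp

/-- Herbst-type bound: the normalized logarithmic moment is controlled by entropies. -/
lemma ofReal_log_integral_exp_div_add_le (hg : Measurable g) (hgi : Integrable g D)
    (hb : 0 < b) (hint : ∀ α ∈ Set.Ioc 0 b, Integrable (fun ω => Real.exp (-α * g ω)) D) :
    ENNReal.ofReal (Real.log (∫ ω, Real.exp (-b * g ω) ∂D) / b + ∫ ω, g ω ∂D) ≤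
      ∫⁻ α in Set.Ioo 0 b, ENNReal.ofReal
        (expEntropy D (fun ω => -α * g ω) / (α ^ 2 * ∫ ω, Real.exp (-α * g ω) ∂D)) := by
  set M : ℝ → ℝ := fun α => ∫ ω, Real.exp (-α * g ω) ∂D with hM
  set k : ℝ → ℝ := fun α => expEntropy D (fun ω => -α * g ω) / (α ^ 2 * M α) with hk
  have Mp : ∀ α ∈ Set.Ioc 0 b, 0 < M α := fun α hα => integral_exp_pos (hint α hα)
  have kn : ∀ α ∈ Set.Ioo 0 b, 0 ≤ k α := fun α hα =>
    div_nonneg (expEntropy_nonneg (hint α ⟨hα.1, hα.2.le⟩) (integrable_neg_mul_mul_exp hint hα))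
      (mul_nonneg (sq_nonneg _) (Mp α ⟨hα.1, hα.2.le⟩).le)
  have step : ∀ ε ∈ Set.Ioo 0 b, ENNReal.ofReal (Real.log (M b) / b - (M ε - 1) / ε) ≤
      ∫⁻ α in Set.Ioo 0 b, ENNReal.ofReal (k α) := by
    intro ε hε
    have hcont : ContinuousOn (fun α => Real.log (M α) / α) (Set.Icc ε b) := by
      have hsub : Set.Icc ε b ⊆ Set.Icc 0 b := Set.Icc_subset_Icc_left hε.1.le
      exact (((continuousOn_integral_exp_neg_mul hg (hint b ⟨hb, le_rfl⟩)).mono hsub).log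
        fun α hα => (Mp α ⟨hε.1.trans_le hα.1, hα.2⟩).ne').div continuousOn_id
        fun α hα => (hε.1.trans_le hα.1).ne'
    have hder : ∀ α ∈ Set.Ioo ε b, HasDerivAt (fun α => Real.log (M α) / α) (k α) α :=
      fun α hα => hasDerivAt_log_integral_exp_div hint ⟨hε.1.trans hα.1, hα.2⟩
    -- A nonnegative derivative of a function continuous up to the endpoints is automatically
    -- integrable.
    have hki : IntegrableOn k (Set.Ioc ε b) :=
      intervalIntegral.integrableOn_deriv_of_nonneg hcont hder
        fun α hα => kn α ⟨hε.1.trans hα.1, hα.2⟩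
    have hFTC := intervalIntegral.integral_eq_sub_of_hasDerivAt_of_le hε.2.le hcont hder
      ((intervalIntegrable_iff_integrableOn_Ioc_of_le hε.2.le).2 hki)
    -- Only an upper bound is needed near `0`, and the limit of `(M ε - 1) / ε` is known.
    have hlog : Real.log (M ε) / ε ≤ (M ε - 1) / ε := by
      have := hε.1
      gcongr
      exact Real.log_le_sub_one_of_pos (Mp ε ⟨hε.1, hε.2.le⟩)
    calc ENNReal.ofReal (Real.log (M b) / b - (M ε - 1) / ε)
        ≤ ENNReal.ofReal (∫ α in Set.Ioo ε b, k α) := by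
          rw [← integral_Ioc_eq_integral_Ioo, ← intervalIntegral.integral_of_le hε.2.le, hFTC]
          exact ENNReal.ofReal_le_ofReal (by linarith)
      _ = ∫⁻ α in Set.Ioo ε b, ENNReal.ofReal (k α) :=
          ofReal_integral_eq_lintegral_ofReal (hki.mono_set Set.Ioo_subset_Ioc_self)
            ((ae_restrict_mem measurableSet_Ioo).mono fun α hα =>
              kn α ⟨hε.1.trans hα.1, hα.2⟩)
      _ ≤ ∫⁻ α in Set.Ioo 0 b, ENNReal.ofReal (k α) :=
          lintegral_mono_set (Set.Ioo_subset_Ioo_left hε.1.le)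
  have hlim := (tendsto_integral_exp_neg_mul_sub_one_div hg hgi hb hint).const_sub
    (Real.log (M b) / b)
  rw [sub_neg_eq_add] at hlim
  refine le_of_tendsto (ENNReal.tendsto_ofReal hlim) ?_
  filter_upwards [Ioo_mem_nhdsGT hb] with ε hε using step ε hε

end

/-! ### Gaussian mixtures with balanced labels -/

section

variable {d : ℕ} {Y : Type*} [MeasurableSpace Y] (p : PMF Y) (μ : Y → Fin d → ℝ)
  (σ : Y → Fin d → NNReal)

lemma lintegral_gaussianMixture {G : EuclideanSpace ℝ (Fin d) × Y → ENNReal}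
    (hG : Measurable G) :
    ∫⁻ z, G z ∂(gaussianMixture p μ σ) =
      ∑' y, p y * ∫⁻ x, G (x, y) ∂(diagGaussian (μ y) (σ y)) := by
  rw [gaussianMixture, lintegral_sum_measure]
  refine tsum_congr fun y => ?_
  rw [lintegral_smul_measure, lintegral_map hG (by fun_prop), smul_eq_mul]

instance : IsProbabilityMeasure (gaussianMixture p μ σ) := by
  constructor
  rw [← lintegral_one, lintegral_gaussianMixture p μ σ measurable_const]
  simp [p.tsum_coe]

variable {p μ σ}

lemma integrable_gaussianMixture_of_integral_eq {F : EuclideanSpace ℝ (Fin d) × Y → ℝ}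
    (hF : Measurable F) (h0 : ∀ z, 0 ≤ F z) {c : ℝ}
    (hint : ∀ y, Integrable (fun x => F (x, y)) (diagGaussian (μ y) (σ y)))
    (hc : ∀ y, ∫ x, F (x, y) ∂(diagGaussian (μ y) (σ y)) = c) :
    Integrable F (gaussianMixture p μ σ) ∧ ∫ z, F z ∂(gaussianMixture p μ σ) = c := by
  have hl : ∫⁻ z, ENNReal.ofReal (F z) ∂(gaussianMixture p μ σ) = ENNReal.ofReal c := by
    rw [lintegral_gaussianMixture p μ σ hF.ennreal_ofReal]
    have : ∀ y, ∫⁻ x, ENNReal.ofReal (F (x, y)) ∂(diagGaussian (μ y) (σ y)) =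
        ENNReal.ofReal c := fun y => by
      rw [← ofReal_integral_eq_lintegral_ofReal (hint y)
        (Filter.Eventually.of_forall fun x => h0 _), hc]
    simp_rw [this]
    rw [ENNReal.tsum_mul_right, p.tsum_coe, one_mul]
  have hi : Integrable F (gaussianMixture p μ σ) := by
    refine ⟨hF.aestronglyMeasurable, ?_⟩
    rw [hasFiniteIntegral_iff_ofReal (Filter.Eventually.of_forall h0), hl]
    exact ENNReal.ofReal_lt_top
  refine ⟨hi, ?_⟩
  obtain ⟨y, -⟩ := p.support_nonempty
  have cn : 0 ≤ c := hc y ▸ integral_nonneg fun x => h0 _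
  rw [integral_eq_lintegral_of_nonneg_ae (Filter.Eventually.of_forall h0)
    hF.aestronglyMeasurable, hl, ENNReal.toReal_ofReal cn]

/-- Logarithmic Sobolev inequality for a Gaussian mixture whose components give `exp f` the
same expectation. -/
lemma gaussianMixture_logSobolev {f : EuclideanSpace ℝ (Fin d) × Y → ℝ} (hfm : Measurable f)
    (hf : ∀ y, Differentiable ℝ fun x => f (x, y)) {c : ℝ}
    (hF : ∀ y, Integrable (fun x => Real.exp (f (x, y))) (diagGaussian (μ y) (σ y)))
    (hc : ∀ y, ∫ x, Real.exp (f (x, y)) ∂(diagGaussian (μ y) (σ y)) = c)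
    (hfF : ∀ y, Integrable (fun x => f (x, y) * Real.exp (f (x, y)))
      (diagGaussian (μ y) (σ y)))
    (hfD : Integrable (fun z => f z * Real.exp (f z)) (gaussianMixture p μ σ))
    {K : EuclideanSpace ℝ (Fin d) × Y → ℝ} (hK : Measurable K)
    (hKf : ∀ x y, K (x, y) = ‖(WithLp.toLp 2 fun i => (σ y i : ℝ) *
      gradient (fun x' => f (x', y)) x i : EuclideanSpace ℝ (Fin d))‖ ^ 2) :
    ENNReal.ofReal (expEntropy (gaussianMixture p μ σ) f) ≤
      1 / 2 * ∫⁻ z, ENNReal.ofReal (K z * Real.exp (f z)) ∂(gaussianMixture p μ σ) := by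
  have hem : Measurable fun z => Real.exp (f z) := Real.measurable_exp.comp hfm
  obtain ⟨hD, hDc⟩ := integrable_gaussianMixture_of_integral_eq (p := p)
    hem (fun z => (Real.exp_pos _).le) hF hc
  -- With a common mean `c`, one nonnegative integrand represents the entropy of the mixture and of
  -- every component, so no term between labels appears.
  rw [ofReal_expEntropy hD hfD hDc, lintegral_gaussianMixture p μ σ (by fun_prop),
    lintegral_gaussianMixture p μ σ (by fun_prop), ← ENNReal.tsum_mul_left]
  refine ENNReal.tsum_le_tsum fun y => ?_
  rw [← ofReal_expEntropy (hF y) (hfF y) (hc y), mul_left_comm]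
  gcongr
  simp only [hKf]
  exact diagGaussian_logSobolev _ _ (hf y) (hF y) (hfF y)

end

/-! ### From one observation to the sample -/

lemma gradient_const_mul_apply {d : ℕ} {f : EuclideanSpace ℝ (Fin d) → ℝ}
    (hf : Differentiable ℝ f) (a : ℝ) (x : EuclideanSpace ℝ (Fin d)) (i : Fin d) :
    gradient (fun x' => a * f x') x i = a * gradient f x i := by
  simp [gradient, fderiv_const_mul (hf x) a]

section

variable {d : ℕ} {Y W : Type*} [Countable Y] [MeasurableSpace Y] [MeasurableSingletonClass Y]
  {loss : W → EuclideanSpace ℝ (Fin d) → Y → ℝ} {w : W}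

lemma measurable_loss (hdiff : ∀ w y, Differentiable ℝ fun x => loss w x y) :
    Measurable fun z : EuclideanSpace ℝ (Fin d) × Y => loss w z.1 z.2 :=
  measurable_from_prod_countable_left fun y => (hdiff w y).continuous.measurable

lemma measurable_scaledGradient (σ : Y → Fin d → NNReal) :
    Measurable fun z : EuclideanSpace ℝ (Fin d) × Y => scaledGradient σ loss w z.1 z.2 :=
  measurable_from_prod_countable_left fun y => 
    measurable_toLp_mul_gradient (σ y) fun x => loss w x y

/-- Bound of the normalized logarithmic moment of the risk on one observation. -/
lemma ofReal_log_moment_add_risk_le (p : PMF Y) (μ : Y → Fin d → ℝ) (σ : Y → Fin d → NNReal)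
    (hdiff : ∀ w y, Differentiable ℝ fun x => loss w x y)
    (hrisk : Integrable (fun z : EuclideanSpace ℝ (Fin d) × Y => loss w z.1 z.2)
      (gaussianMixture p μ σ))
    {b : ℝ} (hb : 0 < b) {c : ℝ → ℝ}
    (hbal : ∀ y, ∀ α ∈ Set.Ioc 0 b,
      Integrable (fun x => Real.exp (-α * loss w x y)) (diagGaussian (μ y) (σ y)) ∧
      ∫ x, Real.exp (-α * loss w x y) ∂(diagGaussian (μ y) (σ y)) = c α) :
    ENNReal.ofReal (Real.log (∫ z, Real.exp (-b * loss w z.1 z.2) ∂(gaussianMixture p μ σ)) / b +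
        risk (gaussianMixture p μ σ) loss w) ≤
      1 / 2 * ∫⁻ z, ENNReal.ofReal (‖scaledGradient σ loss w z.1 z.2‖ ^ 2 *
        ∫ α in (0 : ℝ)..b, Real.exp (-α * loss w z.1 z.2) /
          ∫ z', Real.exp (-α * loss w z'.1 z'.2) ∂(gaussianMixture p μ σ))
        ∂(gaussianMixture p μ σ) := by
  set D := gaussianMixture p μ σ with hD
  set g : EuclideanSpace ℝ (Fin d) × Y → ℝ := fun z => loss w z.1 z.2 with hg
  set M : ℝ → ℝ := fun α => ∫ z, Real.exp (-α * g z) ∂D with hM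
  set K : EuclideanSpace ℝ (Fin d) × Y → ℝ :=
    fun z => ‖scaledGradient σ loss w z.1 z.2‖ ^ 2 with hK
  have gm : Measurable g := measurable_loss hdiff
  have Km : Measurable K := (measurable_scaledGradient σ).norm.pow_const 2
  have hint : ∀ α ∈ Set.Ioc 0 b, Integrable (fun z => Real.exp (-α * g z)) D := fun α hα =>
    (integrable_gaussianMixture_of_integral_eq (by fun_prop) (fun z => (Real.exp_pos _).le)
      (fun y => (hbal y α hα).1) (fun y => (hbal y α hα).2)).1
  have Mp : ∀ α ∈ Set.Icc 0 b, 0 < M α := by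
    intro α hα
    -- Balance is assumed only for `α > 0`; at `α = 0` the mean is `1`.
    rcases hα.1.eq_or_lt with h | h
    · simp [hM, ← h]
    · exact integral_exp_pos (hint α ⟨h, hα.2⟩)
  have Mc : ContinuousOn M (Set.Icc 0 b) :=
    continuousOn_integral_exp_neg_mul gm (hint b ⟨hb, le_rfl⟩)
  have Mm : Measurable M := by
    have h : StronglyMeasurable fun q : ℝ × (EuclideanSpace ℝ (Fin d) × Y) =>
        Real.exp (-q.1 * g q.2) := (by fun_prop : Measurable _).stronglyMeasurable
    exact (h.integral_prod_right (ν := D)).measurable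
  have pointwise : ∀ α ∈ Set.Ioo 0 b,
      ENNReal.ofReal (expEntropy D (fun z => -α * g z) / (α ^ 2 * M α)) ≤
        1 / 2 * ∫⁻ z, ENNReal.ofReal (K z * (Real.exp (-α * g z) / M α)) ∂D := by
    intro α hα
    have hα' : α ∈ Set.Ioc 0 b := ⟨hα.1, hα.2.le⟩
    have hMα := Mp α ⟨hα.1.le, hα.2.le⟩
    have hpos : 0 < α ^ 2 * M α := mul_pos (pow_pos hα.1 2) hMα
    have hlsi := gaussianMixture_logSobolev (p := p) (μ := μ) (σ := σ)
      (f := fun z => -α * g z) (by fun_prop) (fun y => (hdiff w y).const_mul _)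
      (fun y => (hbal y α hα').1) (fun y => (hbal y α hα').2)
      (fun y => integrable_neg_mul_mul_exp (fun α hα => (hbal y α hα).1) hα)
      (integrable_neg_mul_mul_exp hint hα)
      -- The factor `α²` from the gradient of `-α ℓ` cancels the one in the Herbst derivative.
      (K := fun z => α ^ 2 * K z) (Km.const_mul _) (fun x y => by
        simp only [hK, hg, gradient_const_mul_apply (hdiff w y), scaledGradient,
          EuclideanSpace.real_norm_sq_eq, Finset.mul_sum]
        refine Finset.sum_congr rfl fun i _ => ?_
        ring)
    rw [div_eq_inv_mul, ENNReal.ofReal_mul (inv_nonneg.2 hpos.le)]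
    refine (mul_le_mul_right hlsi _).trans (le_of_eq ?_)
    rw [mul_left_comm, ← lintegral_const_mul _ (by fun_prop)]
    congr 1
    refine lintegral_congr fun z => ?_
    rw [← ENNReal.ofReal_mul (inv_nonneg.2 hpos.le)]
    congr 1
    have := hα.1.ne'
    field_simp
  refine (ofReal_log_integral_exp_div_add_le gm hrisk hb hint).trans ?_
  refine (setLIntegral_mono' measurableSet_Ioo pointwise).trans ?_
  have hm : Measurable fun q : ℝ × (EuclideanSpace ℝ (Fin d) × Y) =>
      ENNReal.ofReal (K q.2 * (Real.exp (-q.1 * g q.2) / M q.1)) := by fun_prop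
  rw [lintegral_const_mul _ hm.lintegral_prod_right', lintegral_lintegral_swap hm.aemeasurable]
  refine le_of_eq (congrArg _ (lintegral_congr fun z => ?_))
  -- Continuity and positivity of `M` on `[0, b]` ensure that the inner integral is not the default
  -- value `0`.
  have hii : IntegrableOn (fun α => Real.exp (-α * g z) / M α) (Set.Icc 0 b) :=
    (ContinuousOn.div (by fun_prop) Mc fun α hα => (Mp α hα).ne').integrableOn_Icc
  rw [intervalIntegral.integral_of_le hb.le, integral_Ioc_eq_integral_Ioo,
    ← integral_const_mul, ofReal_integral_eq_lintegral_ofReal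
      ((hii.mono_set Set.Ioo_subset_Icc_self).const_mul _)]
  refine (ae_restrict_mem measurableSet_Ioo).mono fun α hα => ?_
  exact mul_nonneg (sq_nonneg _)
    (div_nonneg (Real.exp_pos _).le (Mp α (Set.Ioo_subset_Icc_self hα)).le)

end

theorem mainTheorem4 {d m : ℕ} {Y W : Type*} [Countable Y] [MeasurableSpace Y]
    [MeasurableSingletonClass Y] (hm : 0 < m)
    (p : PMF Y) (μ : Y → Fin d → ℝ) (σ : Y → Fin d → NNReal)
    (loss : W → EuclideanSpace ℝ (Fin d) → Y → ℝ)
    (hdiff : ∀ w y, Differentiable ℝ fun x => loss w x y)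
    (hrisk : ∀ w, Integrable (fun z : EuclideanSpace ℝ (Fin d) × Y => loss w z.1 z.2)
      (gaussianMixture p μ σ))
    (lam : ℝ) (hlam : 0 < lam) (c : W → ℝ → ℝ)
    (hbalance : ∀ w y, ∀ α ∈ Set.Ioc 0 (lam / m),
      Integrable (fun x => Real.exp (-α * loss w x y)) (diagGaussian (μ y) (σ y)) ∧
      ∫ x, Real.exp (-α * loss w x y) ∂(diagGaussian (μ y) (σ y)) = c w α) :
    ∀ w,
      Integrable (fun S : Fin m → EuclideanSpace ℝ (Fin d) × Y =>
          Real.exp (lam * (risk (gaussianMixture p μ σ) loss w - empiricalRisk loss S w)))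
        (Measure.pi fun _ => gaussianMixture p μ σ) ∧
      ((Real.log (∫ S : Fin m → EuclideanSpace ℝ (Fin d) × Y,
          Real.exp (lam * (risk (gaussianMixture p μ σ) loss w - empiricalRisk loss S w))
          ∂(Measure.pi fun _ => gaussianMixture p μ σ)) : ℝ) : EReal) ≤
      ((ENNReal.ofReal (lam / 2) * ∫⁻ z, ENNReal.ofReal
          (‖scaledGradient σ loss w z.1 z.2‖ ^ 2 *
            ∫ α in (0 : ℝ)..(lam / m),
              Real.exp (-α * loss w z.1 z.2) /
                ∫ z', Real.exp (-α * loss w z'.1 z'.2) ∂(gaussianMixture p μ σ))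
          ∂(gaussianMixture p μ σ) : ENNReal) : EReal) := by
  intro w
  have hm0 : (0 : ℝ) < m := Nat.cast_pos.2 hm
  have hb : 0 < lam / m := div_pos hlam hm0
  set D := gaussianMixture p μ σ with hD
  set L := risk D loss w with hL
  have gm : Measurable fun z : EuclideanSpace ℝ (Fin d) × Y => loss w z.1 z.2 :=
    measurable_loss hdiff
  have hint : Integrable (fun z : EuclideanSpace ℝ (Fin d) × Y =>
      Real.exp (-(lam / m) * loss w z.1 z.2)) D :=
    (integrable_gaussianMixture_of_integral_eq (by fun_prop) (fun z => (Real.exp_pos _).le)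
      (fun y => (hbalance w y _ ⟨hb, le_rfl⟩).1) (fun y => (hbalance w y _ ⟨hb, le_rfl⟩).2)).1
  have hexp : (fun S : Fin m → EuclideanSpace ℝ (Fin d) × Y =>
      Real.exp (lam * (L - empiricalRisk loss S w))) = fun S => Real.exp (lam * L) *
        ∏ i, Real.exp (-(lam / m) * loss w (S i).1 (S i).2) := by
    funext S
    rw [← Real.exp_sum, ← Real.exp_add, ← Finset.mul_sum, empiricalRisk]
    congr 1
    ring
  rw [hexp]
  refine ⟨(Integrable.fintype_prod (f := fun _ : Fin m => fun z : EuclideanSpace ℝ (Fin d) × Y =>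
    Real.exp (-(lam / m) * loss w z.1 z.2)) fun _ => hint).const_mul _, ?_⟩
  rw [integral_const_mul, integral_fintype_prod_eq_pow (fun z : EuclideanSpace ℝ (Fin d) × Y =>
    Real.exp (-(lam / m) * loss w z.1 z.2))]
  have hMp := integral_exp_pos hint
  rw [Real.log_mul (Real.exp_pos _).ne' (pow_pos hMp _).ne', Real.log_exp, Real.log_pow,
    Fintype.card_fin]
  have hscale : lam * L + m * Real.log (∫ z, Real.exp (-(lam / m) * loss w z.1 z.2) ∂D) =
      lam * (Real.log (∫ z, Real.exp (-(lam / m) * loss w z.1 z.2) ∂D) / (lam / m) + L) := by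
    field_simp
    ring
  rw [hscale]
  have hmain := mul_le_mul_right (ofReal_log_moment_add_risk_le p μ σ hdiff (hrisk w) hb
    (hbalance w)) (ENNReal.ofReal lam)
  rw [← ENNReal.ofReal_mul hlam.le, ← mul_assoc] at hmain
  have hhalf : ENNReal.ofReal lam * (1 / 2) = ENNReal.ofReal (lam / 2) := by
    rw [ENNReal.ofReal_div_of_pos two_pos, ENNReal.div_eq_inv_mul, ENNReal.div_eq_inv_mul]
    simp [mul_comm]
  rw [hhalf] at hmain
  -- Passing through `ENNReal.ofReal` truncates at `0`, which only increases the left side.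
  refine le_trans ?_ (EReal.coe_ennreal_le_coe_ennreal_iff.2 hmain)
  rw [EReal.coe_ennreal_ofReal]
  exact EReal.coe_le_coe_iff.2 (le_max_left _ _)
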